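/- For a set $V$ in a metric space, the unit distance graph of $V$ is the graph with vertex set $V$ in which two vertices are adjacent if and only if their distance is exactly $1$. For $\varepsilon > 0$, let $\mathbb{R}\times[0,\varepsilon]$ carry the Euclidean metric of the plane $\mathbb{R}^2$. Then for all real numbers $\varepsilon_1, \varepsilon_2 > 0$, the unit distance graphs of the strips $\mathbb{R}\times[0,\varepsilon_1]$ and $\mathbb{R}\times[0,\varepsilon_2]$ are isomorphic (as graphs) if and only if $\varepsilon_1 = \varepsilon_2$. -/

import Mathlib

/-- The unit distance graph of a set `V` in a metric space: its vertices are the points of `V`, and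
two vertices are adjacent if and only if their distance is exactly `1`. -/
def unitDistGraph {X : Type*} [MetricSpace X] (V : Set X) : SimpleGraph V where
  Adj x y := dist (x : X) (y : X) = 1
  symm := ⟨fun x y h => by rw [dist_comm]; exact h⟩
  loopless := ⟨fun x h => by simp at h⟩

/-- The strip `ℝ × [0, ε]` in the Euclidean plane. -/
def strip (ε : ℝ) : Set (EuclideanSpace ℝ (Fin 2)) :=
  {x | x 1 ∈ Set.Icc 0 ε}

/-!
The width `ε` is recovered from the unit distance graph of `ℝ × [0, ε]` through the horizontal
order of the points.

Two points that are far apart are at graph distance exactly the Euclidean distance rounded up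
(`dist_le_length`, `exists_walk_of_far`), so the graph is quasi-isometric to the line, and an
isomorphism `f` between two strips either preserves or exchanges the two ends
(`preservesRight_or_reversesRight`); composing with a reflection, assume that it preserves them.
For `z` far to the right, `|q - z| < |p - z|` if `q` is to the right of `p`, whereas on a vertical
line the comparison depends on `z`. Comparing graph distances to far vertices therefore determines
whether the first coordinate of `p` is smaller than that of `q`, and `f` acts on first coordinates
by a strictly increasing map `φ` (`PreservesRight.map_lt`, `PreservesRight.map_eq`). Adjacency gives
`φ (t + 1) ≤ φ t + 1`.

Fix an integer `m ≥ ε₁, ε₂`. Two columns at horizontal distance `a < 1` span a zigzag with `m`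
edges and no immediate return if and only if `m * √(1 - a ^ 2) ≤ ε`, that is, `a ≥ c`, where
`c = √(1 - (ε / m) ^ 2)`. Such zigzags are mapped to such zigzags, hence `φ (t + c₁) ≥ φ t + c₂`
(`PreservesRight.sqrt_le_sub`). As `φ` has average speed at most `1`, iteration yields `c₂ ≤ c₁`
(`le_of_monotone_of_step`), that is, `ε₁ ≤ ε₂`, and the inverse isomorphism gives equality.
-/

namespace StripGraph

variable {ε ε₁ ε₂ : ℝ}

/-! ### Coordinates in the strip -/

/-- The point of the strip with coordinates `(a, b)`. -/
def mkPt (a b : ℝ) (hb : b ∈ Set.Icc 0 ε) : strip ε :=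
  ⟨!₂[a, b], by simpa [strip] using hb⟩

@[simp] lemma mkPt_zero (a b : ℝ) (hb : b ∈ Set.Icc 0 ε) : (mkPt a b hb).1 0 = a := by
  simp [mkPt]

@[simp] lemma mkPt_one (a b : ℝ) (hb : b ∈ Set.Icc 0 ε) : (mkPt a b hb).1 1 = b := by
  simp [mkPt]

lemma height_mem (p : strip ε) : p.1 1 ∈ Set.Icc 0 ε := p.2

lemma sq_sub_height_le (p q : strip ε) : (p.1 1 - q.1 1) ^ 2 ≤ ε ^ 2 := by
  obtain ⟨hp0, hp1⟩ := Set.mem_Icc.mp (height_mem p)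
  obtain ⟨hq0, hq1⟩ := Set.mem_Icc.mp (height_mem q)
  apply sq_le_sq' <;> linarith

lemma ext_coord {p q : strip ε} (h0 : p.1 0 = q.1 0) (h1 : p.1 1 = q.1 1) : p = q := by
  apply Subtype.ext
  ext i
  fin_cases i
  · exact h0
  · exact h1

lemma dist_sq (p q : EuclideanSpace ℝ (Fin 2)) :
    dist p q ^ 2 = (p 0 - q 0) ^ 2 + (p 1 - q 1) ^ 2 := by
  rw [EuclideanSpace.dist_eq, Real.sq_sqrt (by positivity), Fin.sum_univ_two,
    Real.dist_eq, Real.dist_eq, sq_abs, sq_abs]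

lemma adj_iff {p q : strip ε} : (unitDistGraph (strip ε)).Adj p q ↔
    (p.1 0 - q.1 0) ^ 2 + (p.1 1 - q.1 1) ^ 2 = 1 := by
  rw [← dist_sq]
  change dist p.1 q.1 = 1 ↔ _
  exact (pow_eq_one_iff_of_nonneg dist_nonneg two_ne_zero).symm

lemma abs_sub_le_dist (p q : EuclideanSpace ℝ (Fin 2)) : |p 0 - q 0| ≤ dist p q := by
  refine abs_le_of_sq_le_sq ?_ dist_nonneg
  rw [dist_sq]
  nlinarith [sq_nonneg (p 1 - q 1)]

lemma dist_le_add (hε : 0 < ε) (p q : strip ε) : dist p.1 q.1 ≤ |p.1 0 - q.1 0| + ε := by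
  apply le_of_sq_le_sq _ (by positivity)
  rw [dist_sq]
  have h1 := sq_sub_height_le p q
  nlinarith [sq_abs (p.1 0 - q.1 0), abs_nonneg (p.1 0 - q.1 0)]

/-! ### Graph distance between far points -/

lemma dist_le_length {p q : strip ε} (w : (unitDistGraph (strip ε)).Walk p q) :
    dist p.1 q.1 ≤ w.length := by
  induction w with
  | nil => simp
  | @cons u v _ h w ih =>
    have h1 : dist u.1 v.1 = 1 := h
    have := dist_triangle u.1 v.1 _ |>.trans (add_le_add h1.le ih)
    simp only [SimpleGraph.Walk.length_cons, Nat.cast_add, Nat.cast_one]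
    linarith

lemma lineMap_mem (p q : strip ε) {t : ℝ} (ht : t ∈ Set.Icc (0 : ℝ) 1) :
    AffineMap.lineMap p.1 q.1 t ∈ strip ε := by
  have hconv : Convex ℝ (strip ε) := by
    have : strip ε = (EuclideanSpace.proj 1 : EuclideanSpace ℝ (Fin 2) →L[ℝ] ℝ).toLinearMap ⁻¹'
        Set.Icc 0 ε := rfl
    rw [this]
    exact (convex_Icc 0 ε).linear_preimage _
  exact hconv.lineMap_mem p.2 q.2 ht

/-- Two points at distance `2 * s` are opposite vertices of a unit rhombus. If `s` is so close to
`1` that the rhombus has half-width at most `ε / 2`, then one of its other vertices is in the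
strip. -/
lemma exists_common_neighbor {p q : strip ε} {s : ℝ} (hs0 : 0 < s) (hs1 : s ≤ 1)
    (hs : 1 - s ^ 2 ≤ (ε / 2) ^ 2) (hε : 0 < ε) (hd : dist p.1 q.1 = 2 * s) :
    ∃ r, (unitDistGraph (strip ε)).Adj p r ∧ (unitDistGraph (strip ε)).Adj r q := by
  obtain ⟨hp0, hp1⟩ := Set.mem_Icc.mp (height_mem p)
  obtain ⟨hq0, hq1⟩ := Set.mem_Icc.mp (height_mem q)
  have hsq := dist_sq p.1 q.1
  rw [hd] at hsq
  set l := √(1 - s ^ 2) / (2 * s) with hl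
  have hn : 0 ≤ 1 - s ^ 2 := by nlinarith
  have hl2 : l ^ 2 * (4 * s ^ 2) = 1 - s ^ 2 := by
    rw [hl, div_pow, Real.sq_sqrt hn]
    field_simp
    ring
  have hbd : |l * (q.1 0 - p.1 0)| ≤ ε / 2 := by
    refine abs_le_of_sq_le_sq ?_ (by positivity)
    nlinarith [mul_nonneg (sq_nonneg l) (sq_nonneg (p.1 1 - q.1 1))]
  obtain ⟨hb1, hb2⟩ := abs_le.mp hbd
  have key : ∀ l' : ℝ, l' ^ 2 = l ^ 2 →
      (hm : (p.1 1 + q.1 1) / 2 + l' * (q.1 0 - p.1 0) ∈ Set.Icc 0 ε) →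
      ∃ r, (unitDistGraph (strip ε)).Adj p r ∧ (unitDistGraph (strip ε)).Adj r q := by
    intro l' hl' hm
    rw [← hl'] at hl2
    refine ⟨mkPt ((p.1 0 + q.1 0) / 2 - l' * (q.1 1 - p.1 1)) _ hm, adj_iff.mpr ?_,
      adj_iff.mpr ?_⟩ <;> simp only [mkPt_zero, mkPt_one] <;>
      linear_combination (-(1 / 4) - l' ^ 2) * hsq + hl2
  by_cases hmid : (p.1 1 + q.1 1) / 2 + l * (q.1 0 - p.1 0) ∈ Set.Icc 0 ε
  · exact key l rfl hmid
  · refine key (-l) (by ring) ?_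
    rw [Set.mem_Icc, not_and_or, not_le, not_le] at hmid
    rcases hmid with h | h <;> constructor <;> linarith

/-- A chain of `k` congruent unit rhombi along the segment from `p` to `q`. -/
lemma exists_even_walk (hε : 0 < ε) {s : ℝ} (hs0 : 0 < s) (hs1 : s ≤ 1)
    (hs : 1 - s ^ 2 ≤ (ε / 2) ^ 2) (k : ℕ) (p q : strip ε) (hd : dist p.1 q.1 = k * (2 * s)) :
    ∃ w : (unitDistGraph (strip ε)).Walk p q, w.length = 2 * k := by
  induction k generalizing p with
  | zero =>
    have : p = q := Subtype.ext (dist_eq_zero.mp (by simpa using hd))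
    subst this
    exact ⟨.nil, rfl⟩
  | succ k ih =>
    have hk : (0 : ℝ) < k + 1 := by positivity
    have hk1 : (1 : ℝ) ≤ k + 1 := by linarith [Nat.cast_nonneg (α := ℝ) k]
    have ht : 1 / ((k : ℝ) + 1) ∈ Set.Icc (0 : ℝ) 1 :=
      ⟨by positivity, by rw [div_le_one hk]; exact hk1⟩
    obtain ⟨r, hr⟩ : ∃ r : strip ε, r.1 = AffineMap.lineMap p.1 q.1 (1 / ((k : ℝ) + 1)) :=
      ⟨⟨_, lineMap_mem p q ht⟩, rfl⟩
    push_cast at hd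
    have h1 : dist p.1 r.1 = 2 * s := by
      rw [hr, dist_left_lineMap, hd, Real.norm_of_nonneg ht.1]
      field_simp
    have h2 : dist r.1 q.1 = k * (2 * s) := by
      rw [hr, dist_lineMap_right, hd, Real.norm_of_nonneg (by linarith [ht.2])]
      field_simp
      ring
    obtain ⟨u, hpu, hur⟩ := exists_common_neighbor hs0 hs1 hs hε h1
    obtain ⟨w, hw⟩ := ih r h2
    exact ⟨.cons hpu (.cons hur w), by simp [hw]; ring⟩

/-- In the strip of width `ε`, points at least this far apart are joined by a walk as short as
their Euclidean distance permits. -/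
noncomputable def farRadius (ε : ℝ) : ℝ := 8 / ε ^ 2 + 2

/-- If `d` is large and rounds up to `n`, steps of projected length `d / n` along the segment are
long enough for `exists_common_neighbor`. -/
lemma one_sub_sq_le (hε : 0 < ε) {d n : ℝ} (hd : 8 / ε ^ 2 ≤ d) (hdn : d ≤ n)
    (hn : n < d + 1) : 0 < d / n ∧ d / n ≤ 1 ∧ 1 - (d / n) ^ 2 ≤ (ε / 2) ^ 2 := by
  have h8 : 0 < 8 / ε ^ 2 := by positivity
  have hn0 : 0 < n := by linarith
  have hs1 : d / n ≤ 1 := (div_le_one hn0).mpr hdn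
  refine ⟨div_pos (by linarith) hn0, hs1, ?_⟩
  have h1 : 1 - d / n ≤ 1 / n := by
    rw [one_sub_div hn0.ne']
    gcongr
    linarith
  have h2 : 1 / n ≤ ε ^ 2 / 8 := by
    rw [← one_div_div 8 (ε ^ 2)]
    exact one_div_le_one_div_of_le h8 (by linarith)
  nlinarith

/-- Far apart, graph distance is the Euclidean distance rounded up: a suitable chain of unit
rhombi along the segment joins the points, after one unit step along it if the number of steps is
odd. -/
lemma exists_walk_of_far (hε : 0 < ε) {p q : strip ε} (hR : farRadius ε ≤ dist p.1 q.1) {n : ℕ}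
    (hn : dist p.1 q.1 ≤ n) : ∃ w : (unitDistGraph (strip ε)).Walk p q, w.length ≤ n := by
  set d := dist p.1 q.1 with hd
  have h8 : 0 < 8 / ε ^ 2 := by positivity
  unfold farRadius at hR
  have hN1 : d ≤ ⌈d⌉₊ := Nat.le_ceil d
  have hN2 : (⌈d⌉₊ : ℝ) < d + 1 := Nat.ceil_lt_add_one (by linarith)
  have hNn : ⌈d⌉₊ ≤ n := Nat.ceil_le.mpr hn
  generalize ⌈d⌉₊ = N at *
  rcases Nat.even_or_odd' N with ⟨k, rfl | rfl⟩
  · push_cast at hN1 hN2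
    obtain ⟨a, b, c⟩ := one_sub_sq_le hε (by linarith) hN1 hN2
    have hk : (k : ℝ) ≠ 0 := by
      intro h
      rw [h] at hN1
      linarith
    obtain ⟨w, hw⟩ := exists_even_walk hε a b c k p q (by rw [← hd]; field_simp)
    exact ⟨w, by omega⟩
  · push_cast at hN1 hN2
    obtain ⟨a, b, c⟩ := one_sub_sq_le (d := d - 1) (n := 2 * k) hε (by linarith) (by linarith)
      (by linarith)
    have hk : (k : ℝ) ≠ 0 := by
      intro h
      rw [h] at hN1
      linarith
    have hd0 : 0 < d := by linarith
    have ht : 1 / d ∈ Set.Icc (0 : ℝ) 1 :=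
      ⟨by positivity, by rw [div_le_one hd0]; linarith⟩
    obtain ⟨r, hr⟩ : ∃ r : strip ε, r.1 = AffineMap.lineMap p.1 q.1 (1 / d) :=
      ⟨⟨_, lineMap_mem p q ht⟩, rfl⟩
    have h1 : dist p.1 r.1 = 1 := by
      rw [hr, dist_left_lineMap, Real.norm_of_nonneg ht.1, ← hd]
      field_simp
    have h2 : dist r.1 q.1 = d - 1 := by
      rw [hr, dist_lineMap_right, Real.norm_of_nonneg (by linarith [ht.2]), ← hd]
      field_simp
    obtain ⟨w, hw⟩ := exists_even_walk hε a b c k r q (by rw [h2]; field_simp)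
    have hadj : (unitDistGraph (strip ε)).Adj p r := h1
    exact ⟨.cons hadj w, by simp only [SimpleGraph.Walk.length_cons]; omega⟩

/-- Points that are close together are joined through an auxiliary point far to the right. -/
lemma exists_walk_le_add (hε : 0 < ε) : ∃ C : ℝ, ∀ p q : strip ε,
    ∃ w : (unitDistGraph (strip ε)).Walk p q, (w.length : ℝ) ≤ |p.1 0 - q.1 0| + C := by
  refine ⟨2 * farRadius ε + 2 * ε + 2, fun p q => ?_⟩
  have hR : 0 < farRadius ε := by unfold farRadius; positivity
  set M := max (p.1 0) (q.1 0) with hM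
  let z : strip ε := mkPt (M + farRadius ε) 0 (Set.left_mem_Icc.mpr hε.le)
  have hz : z.1 0 = M + farRadius ε := mkPt_zero _ _ _
  have key : ∀ u : strip ε, u.1 0 ≤ M → ∃ w : (unitDistGraph (strip ε)).Walk u z,
      (w.length : ℝ) ≤ M - u.1 0 + farRadius ε + ε + 1 := by
    intro u hu
    have h1 := abs_sub_le_dist u.1 z.1
    have h2 := dist_le_add hε u z
    have h3 : |u.1 0 - z.1 0| = M + farRadius ε - u.1 0 := by
      rw [hz, abs_sub_comm, abs_of_nonneg (by linarith)]
    rw [h3] at h1 h2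
    obtain ⟨w, hw⟩ := exists_walk_of_far hε (by linarith) (Nat.le_ceil (dist u.1 z.1))
    refine ⟨w, ?_⟩
    have h4 : (w.length : ℝ) ≤ ⌈dist u.1 z.1⌉₊ := by exact_mod_cast hw
    have h5 := Nat.ceil_lt_add_one (dist_nonneg (x := u.1) (y := z.1))
    linarith
  obtain ⟨w₁, h₁⟩ := key p (le_max_left _ _)
  obtain ⟨w₂, h₂⟩ := key q (le_max_right _ _)
  refine ⟨w₁.append w₂.reverse, ?_⟩
  rw [SimpleGraph.Walk.length_append, SimpleGraph.Walk.length_reverse, Nat.cast_add]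
  have h3 : 2 * M = p.1 0 + q.1 0 + |p.1 0 - q.1 0| := by
    rcases abs_cases (p.1 0 - q.1 0) with ⟨e, h⟩ | ⟨e, h⟩
    · rw [e, hM, max_eq_left (by linarith)]
      ring
    · rw [e, hM, max_eq_right (by linarith)]
      ring
  linarith

/-! ### Isomorphisms and the two ends of the strip -/

/-- Isomorphisms are coarsely Lipschitz in the first coordinate, with constant `1`. -/
lemma exists_abs_sub_map_le (hε₁ : 0 < ε₁) :
    ∃ C : ℝ, ∀ f : unitDistGraph (strip ε₁) ≃g unitDistGraph (strip ε₂), ∀ p q,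
      |(f p).1 0 - (f q).1 0| ≤ |p.1 0 - q.1 0| + C := by
  obtain ⟨C, hC⟩ := exists_walk_le_add hε₁
  refine ⟨C, fun f p q => ?_⟩
  obtain ⟨w, hw⟩ := hC p q
  have h1 := dist_le_length (w.map f.toHom)
  rw [SimpleGraph.Walk.length_map] at h1
  exact (abs_sub_le_dist _ _).trans (h1.trans hw)

/-- A map between strips that sends the right end of one to the right end of the other. -/
def PreservesRight (f : strip ε₁ → strip ε₂) : Prop :=
  ∀ M : ℝ, ∃ K : ℝ, ∀ z : strip ε₁, K ≤ z.1 0 → M ≤ (f z).1 0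

/-- A map between strips that sends the right end of one to the left end of the other. -/
def ReversesRight (f : strip ε₁ → strip ε₂) : Prop :=
  ∀ M : ℝ, ∃ K : ℝ, ∀ z : strip ε₁, K ≤ z.1 0 → (f z).1 0 ≤ M

/-- Images of far points `z`, `w` on the right are far from the image of the origin; if they were
on different sides of it, they would be too far from each other. -/
lemma preservesRight_or_reversesRight (hε₁ : 0 < ε₁) (hε₂ : 0 < ε₂)
    (f : unitDistGraph (strip ε₁) ≃g unitDistGraph (strip ε₂)) :
    PreservesRight f ∨ ReversesRight f := by
  obtain ⟨C₁, h₁⟩ := exists_abs_sub_map_le (ε₂ := ε₂) hε₁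
  obtain ⟨C₂, h₂⟩ := exists_abs_sub_map_le (ε₂ := ε₁) hε₂
  replace h₁ := h₁ f
  replace h₂ : ∀ p q, |p.1 0 - q.1 0| ≤ |(f p).1 0 - (f q).1 0| + C₂ := fun p q => by
    simpa using h₂ f.symm (f p) (f q)
  let o : strip ε₁ := mkPt 0 0 (Set.left_mem_Icc.mpr hε₁.le)
  have ho : o.1 0 = 0 := mkPt_zero _ _ _
  have far : ∀ z : strip ε₁, z.1 0 - C₂ ≤ |(f z).1 0 - (f o).1 0| := fun z => by
    have := h₂ z o
    rw [ho, sub_zero] at this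
    linarith [le_abs_self (z.1 0)]
  set K := |C₁| + 2 * |C₂| + 1 with hK
  have aC₁ := le_abs_self C₁
  have aC₂ := le_abs_self C₂
  have a₁ := abs_nonneg C₁
  have a₂ := abs_nonneg C₂
  by_cases h : ∃ w : strip ε₁, K ≤ w.1 0 ∧ (f w).1 0 < (f o).1 0
  · right
    obtain ⟨w, hwK, hw⟩ := h
    intro M
    refine ⟨max K ((f o).1 0 - M + C₂), fun z hz => ?_⟩
    have hz1 := (le_max_left _ _).trans hz
    have hz2 := (le_max_right _ _).trans hz
    have fz := far z
    have fw := far w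
    have hzw := h₁ z w
    rw [abs_of_neg (by linarith)] at fw
    rcases le_total ((f o).1 0) ((f z).1 0) with hoz | hoz
    · rw [abs_of_nonneg (by linarith)] at fz
      have e1 := le_abs_self ((f z).1 0 - (f w).1 0)
      rcases abs_cases (z.1 0 - w.1 0) with ⟨e, _⟩ | ⟨e, _⟩ <;> rw [e] at hzw <;> linarith
    · rw [abs_of_nonpos (by linarith)] at fz
      linarith
  · left
    push Not at h
    intro M
    refine ⟨max K (M - (f o).1 0 + C₂), fun z hz => ?_⟩
    have hz1 := h z ((le_max_left _ _).trans hz)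
    have hz2 := (le_max_right _ _).trans hz
    have fz := far z
    rw [abs_of_nonneg (by linarith)] at fz
    linarith

lemma PreservesRight.symm (hε₁ : 0 < ε₁) (hε₂ : 0 < ε₂)
    {f : unitDistGraph (strip ε₁) ≃g unitDistGraph (strip ε₂)} (hf : PreservesRight f) :
    PreservesRight f.symm := by
  refine (preservesRight_or_reversesRight hε₂ hε₁ f.symm).resolve_right fun h => ?_
  obtain ⟨K₁, h₁⟩ := h 0
  obtain ⟨K₂, h₂⟩ := hf K₁
  have h3 := h₁ _ (h₂ (mkPt (max K₂ 1) 0 (Set.left_mem_Icc.mpr hε₁.le)) (by simp))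
  simp only [RelIso.symm_apply_apply, mkPt_zero] at h3
  linarith [le_max_right K₂ 1]

/-- The reflection `(x, y) ↦ (-x, y)` of the strip, as an automorphism of its unit distance
graph. -/
def reflection (ε : ℝ) : unitDistGraph (strip ε) ≃g unitDistGraph (strip ε) where
  toFun p := mkPt (-p.1 0) (p.1 1) (height_mem p)
  invFun p := mkPt (-p.1 0) (p.1 1) (height_mem p)
  left_inv p := ext_coord (by simp) (by simp)
  right_inv p := ext_coord (by simp) (by simp)
  map_rel_iff' {p q} := by
    simp only [Equiv.coe_fn_mk, adj_iff, mkPt_zero, mkPt_one]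
    rw [show (-p.1 0 - -q.1 0) ^ 2 = (p.1 0 - q.1 0) ^ 2 by ring]

lemma exists_preservesRight (hε₁ : 0 < ε₁) (hε₂ : 0 < ε₂)
    (f : unitDistGraph (strip ε₁) ≃g unitDistGraph (strip ε₂)) :
    ∃ g : unitDistGraph (strip ε₁) ≃g unitDistGraph (strip ε₂), PreservesRight g := by
  rcases preservesRight_or_reversesRight hε₁ hε₂ f with h | h
  · exact ⟨f, h⟩
  · refine ⟨f.trans (reflection ε₂), fun M => ?_⟩
    obtain ⟨K, hK⟩ := h (-M)
    refine ⟨K, fun z hz => ?_⟩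
    have e : ((f.trans (reflection ε₂)) z).1 0 = -(f z).1 0 := mkPt_zero _ _ (height_mem (f z))
    rw [e]
    exact le_neg_of_le_neg (hK z hz)

/-! ### The order of first coordinates -/

/-- Seen from far to the right, `q` is closer than `p` if it is to the right of `p`, whatever the
heights. -/
lemma exists_walk_of_lt (hε : 0 < ε) {p q : strip ε} (h : p.1 0 < q.1 0) :
    ∃ K : ℝ, ∀ z : strip ε, K ≤ z.1 0 → ∀ n : ℕ,
      (∃ w : (unitDistGraph (strip ε)).Walk p z, w.length ≤ n) →
      ∃ w : (unitDistGraph (strip ε)).Walk q z, w.length ≤ n := by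
  refine ⟨max (q.1 0 + farRadius ε) (ε ^ 2 / (q.1 0 - p.1 0) + q.1 0), fun z hz n ⟨w, hw⟩ => ?_⟩
  have hz1 := (le_max_left _ _).trans hz
  have hz2 := (le_max_right _ _).trans hz
  have hR : 0 < farRadius ε := by unfold farRadius; positivity
  refine exists_walk_of_far hε ?_ ?_
  · refine le_trans ?_ (abs_sub_le_dist _ _)
    rw [abs_sub_comm]
    exact le_trans (by linarith) (le_abs_self _)
  · have h1 := dist_le_length w
    have h2 : (w.length : ℝ) ≤ n := by exact_mod_cast hw
    refine le_trans (le_of_sq_le_sq ?_ dist_nonneg) (h1.trans h2)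
    rw [dist_sq, dist_sq]
    have h3 := sq_sub_height_le q z
    have hpos : 0 < q.1 0 - p.1 0 := by linarith
    have h4 : ε ^ 2 ≤ (z.1 0 - q.1 0) * (q.1 0 - p.1 0) := by
      rw [← div_le_iff₀ hpos]
      linarith
    nlinarith [sq_nonneg (p.1 1 - z.1 1)]

/-- The witness `z` lies at integer distance `n` from `p` at the same height, so that `q`, even if
it is in the same column as `p`, is at distance more than `n` from it. -/
lemma exists_walk_and_not_walk (hε : 0 < ε) {p q : strip ε} (h : q.1 0 ≤ p.1 0) (hne : p ≠ q)
    (K : ℝ) : ∃ z : strip ε, K ≤ z.1 0 ∧ ∃ n : ℕ,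
      (∃ w : (unitDistGraph (strip ε)).Walk p z, w.length ≤ n) ∧
      ¬ ∃ w : (unitDistGraph (strip ε)).Walk q z, w.length ≤ n := by
  obtain ⟨n, hn⟩ := exists_nat_ge (max (farRadius ε) (K - p.1 0))
  have hn1 := (le_max_left _ _).trans hn
  have hn2 := (le_max_right _ _).trans hn
  have hR : 0 < farRadius ε := by unfold farRadius; positivity
  have hn0 : (0 : ℝ) < n := by linarith
  let z : strip ε := mkPt (p.1 0 + n) (p.1 1) (height_mem p)
  have hz0 : z.1 0 = p.1 0 + n := mkPt_zero _ _ _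
  have hz1 : z.1 1 = p.1 1 := mkPt_one _ _ _
  have hpz : dist p.1 z.1 = n := by
    rw [← sq_eq_sq₀ dist_nonneg hn0.le, dist_sq, hz0, hz1]
    ring
  refine ⟨z, by linarith, n, exists_walk_of_far hε (by linarith) hpz.le, ?_⟩
  rintro ⟨w, hw⟩
  have h1 : dist q.1 z.1 ≤ n := (dist_le_length w).trans (by exact_mod_cast hw)
  rw [← sq_le_sq₀ dist_nonneg hn0.le, dist_sq, hz0, hz1] at h1
  have h2 : (p.1 0 - q.1 0) = 0 := by
    nlinarith [sq_nonneg (p.1 0 - q.1 0), sq_nonneg (q.1 1 - p.1 1)]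
  have h3 : q.1 1 - p.1 1 = 0 := by
    have : q.1 0 = p.1 0 := by linarith
    rw [this] at h1
    exact pow_eq_zero_iff two_ne_zero |>.mp (le_antisymm (by linarith) (sq_nonneg _))
  exact hne (ext_coord (by linarith) (by linarith))

/-- Isomorphisms preserve the order of first coordinates because that order can be read off the
graph: `q` lies to the right of `p` (or equals it) exactly if every vertex `z` sufficiently far to
the right is at most as far from `q` as from `p` in the graph. -/
lemma PreservesRight.map_lt (hε₁ : 0 < ε₁) (hε₂ : 0 < ε₂)
    {f : unitDistGraph (strip ε₁) ≃g unitDistGraph (strip ε₂)} (hf : PreservesRight f)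
    {p q : strip ε₁} (h : p.1 0 < q.1 0) : (f p).1 0 < (f q).1 0 := by
  by_contra! hle
  obtain ⟨K, hK⟩ := exists_walk_of_lt hε₁ h
  obtain ⟨K', hK'⟩ := hf.symm hε₁ hε₂ K
  have hne : f p ≠ f q := fun e => h.ne (by rw [f.injective e])
  obtain ⟨z, hz, n, ⟨w, hw⟩, hno⟩ := exists_walk_and_not_walk hε₂ hle hne K'
  obtain ⟨w', hw'⟩ := hK (f.symm z) (hK' z hz) n
    ⟨(w.map f.symm.toHom).copy (f.symm_apply_apply p) rfl, by simpa using hw⟩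
  exact hno ⟨(w'.map f.toHom).copy rfl (f.apply_symm_apply z), by simpa using hw'⟩

lemma PreservesRight.map_eq (hε₁ : 0 < ε₁) (hε₂ : 0 < ε₂)
    {f : unitDistGraph (strip ε₁) ≃g unitDistGraph (strip ε₂)} (hf : PreservesRight f)
    {p q : strip ε₁} (h : p.1 0 = q.1 0) : (f p).1 0 = (f q).1 0 := by
  have key : ∀ u v : strip ε₁, (f u).1 0 < (f v).1 0 → u.1 0 < v.1 0 := fun u v huv => by
    simpa using (hf.symm hε₁ hε₂).map_lt hε₂ hε₁ huv
  rcases lt_trichotomy ((f p).1 0) ((f q).1 0) with h' | h' | h'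
  · exact absurd h (key _ _ h').ne
  · exact h'
  · exact absurd h (key _ _ h').ne'

/-! ### Zigzags between two columns -/

/-- Real numbers with steps of constant size and no immediate return move steadily in one
direction. -/
lemma sq_sub_eq_of_steps {y : ℕ → ℝ} {h : ℝ} {m : ℕ}
    (hstep : ∀ i < m, (y i - y (i + 1)) ^ 2 = h ^ 2)
    (hne : ∀ i, i + 2 ≤ m → y i ≠ y (i + 2)) : (y 0 - y m) ^ 2 = (m * h) ^ 2 := by
  rcases Nat.eq_zero_or_pos m with rfl | hm
  · simp
  have key : ∀ k, k < m → y (k + 1) - y k = y 1 - y 0 := by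
    intro k
    induction k with
    | zero => intro _; simp
    | succ k ih =>
      intro hk
      have i1 := ih (by omega)
      have e := (hstep (k + 1) hk).trans (hstep k (by omega)).symm
      rcases sq_eq_sq_iff_eq_or_eq_neg.mp e with e | e
      · linarith
      · exact absurd (by linarith) (hne k hk)
  have key2 : ∀ k, k ≤ m → y k - y 0 = k * (y 1 - y 0) := by
    intro k
    induction k with
    | zero => intro _; simp
    | succ k ih =>
      intro hk
      push_cast
      linarith [ih (by omega), key k hk]
  have h1 := key2 m le_rfl
  have h2 := hstep 0 hm
  rw [zero_add] at h2
  rw [mul_pow, ← h2, ← neg_sub (y m), h1]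
  ring

/-- Between the columns over `s` and `s + a`, where `0 ≤ a < 1`, all edges have height
`√(1 - a ^ 2) > 0`, so a walk with `m` edges that never turns back fits into the strip if and only
if `m * √(1 - a ^ 2) ≤ ε`, that is, `√(1 - (ε / m) ^ 2) ≤ a`. The image of the zigzag that starts
at the bottom over `s` is such a walk. -/
lemma PreservesRight.sqrt_le_sub (hε₁ : 0 < ε₁) (hε₂ : 0 < ε₂)
    {f : unitDistGraph (strip ε₁) ≃g unitDistGraph (strip ε₂)} (hf : PreservesRight f)
    {m : ℕ} (hm : ε₁ ≤ m) {p q r : strip ε₁}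
    (hq : q.1 0 = p.1 0 + √(1 - (ε₁ / m) ^ 2)) (hpr : (f r).1 0 ≤ (f p).1 0 + 1)
    (hr : r.1 0 = p.1 0 + 1) :
    √(1 - (ε₂ / m) ^ 2) ≤ (f q).1 0 - (f p).1 0 := by
  have hm0 : (0 : ℝ) < m := by linarith
  set h := ε₁ / m with hh
  have hh0 : 0 < h := by positivity
  have hh1 : h ≤ 1 := (div_le_one hm0).mpr hm
  have hmh : m * h = ε₁ := by rw [hh]; field_simp
  set c := √(1 - h ^ 2) with hc
  have hc2 : c ^ 2 = 1 - h ^ 2 := Real.sq_sqrt (by nlinarith)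
  have hc0 : 0 ≤ c := Real.sqrt_nonneg _
  have hc1 : c < 1 := by nlinarith
  set a := (f q).1 0 - (f p).1 0 with ha
  have ha1 : a < 1 := by
    have := hf.map_lt hε₁ hε₂ (p := q) (q := r) (by linarith)
    linarith
  have ha0 : 0 ≤ a := by
    rcases hc0.eq_or_lt with e | e
    · have := hf.map_eq hε₁ hε₂ (p := p) (q := q) (by linarith)
      linarith
    · have := hf.map_lt hε₁ hε₂ (p := p) (q := q) (by linarith)
      linarith
  -- The truncation at `ε₁` keeps `v i` in the strip for `i > m` and has no effect for `i ≤ m`.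
  let v : ℕ → strip ε₁ := fun i =>
    mkPt (if Even i then p.1 0 else q.1 0) (min (i * h) ε₁)
      ⟨le_min (by positivity) hε₁.le, min_le_right _ _⟩
  have hv0 : ∀ i, (v i).1 0 = if Even i then p.1 0 else q.1 0 := fun i => mkPt_zero _ _ _
  have hv1 : ∀ i ≤ m, (v i).1 1 = i * h := fun i hi => by
    have : (i : ℝ) * h ≤ m * h := by gcongr
    rw [hmh] at this
    exact (mkPt_one _ _ _).trans (min_eq_left this)
  have hfv0 : ∀ i, (f (v i)).1 0 = if Even i then (f p).1 0 else (f q).1 0 := fun i => by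
    split_ifs with hi
    · exact hf.map_eq hε₁ hε₂ (by rw [hv0, if_pos hi])
    · exact hf.map_eq hε₁ hε₂ (by rw [hv0, if_neg hi])
  have hadj : ∀ i < m, (unitDistGraph (strip ε₁)).Adj (v i) (v (i + 1)) := fun i hi => by
    rw [adj_iff, hv0, hv0, hv1 i hi.le, hv1 (i + 1) hi, hq]
    push_cast
    rcases Nat.even_or_odd i with e | e
    · rw [if_pos e, if_neg (by simpa [Nat.even_add_one] using e)]
      linear_combination hc2
    · rw [if_neg (by simpa using e), if_pos e.add_one]
      linear_combination hc2
  have hna : 0 < 1 - a ^ 2 := by nlinarith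
  have hstep : ∀ i < m, ((f (v i)).1 1 - (f (v (i + 1))).1 1) ^ 2 = √(1 - a ^ 2) ^ 2 := by
    intro i hi
    have h1 := adj_iff.mp (f.map_adj_iff.mpr (hadj i hi))
    rw [hfv0, hfv0] at h1
    rw [Real.sq_sqrt hna.le]
    rcases Nat.even_or_odd i with e | e
    · rw [if_pos e, if_neg (by simpa [Nat.even_add_one] using e)] at h1
      linear_combination h1
    · rw [if_neg (by simpa using e), if_pos e.add_one] at h1
      linear_combination h1
  have hne : ∀ i, i + 2 ≤ m → (f (v i)).1 1 ≠ (f (v (i + 2))).1 1 := by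
    intro i hi e
    have e2 : v i = v (i + 2) :=
      f.injective (ext_coord (by simp [hfv0, Nat.even_add]) e)
    have e3 := congrArg (fun u : strip ε₁ => u.1 1) e2
    simp only [hv1 i (by omega), hv1 (i + 2) hi] at e3
    push_cast at e3
    linarith
  have hfin := sq_sub_eq_of_steps hstep hne
  have b3 := sq_sub_height_le (f (v 0)) (f (v m))
  rw [hfin, mul_pow, Real.sq_sqrt hna.le] at b3
  rw [Real.sqrt_le_left ha0, div_pow]
  have : 1 - a ^ 2 ≤ ε₂ ^ 2 / (m : ℝ) ^ 2 := by
    rw [le_div_iff₀ (by positivity)]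
    linarith
  linarith

/-! ### Comparison of the widths -/

/-- Monotone maps of the line that advance by at most `1` over each unit interval have average
speed at most `1`, so they cannot advance by more than `a` over each interval of length `a`. -/
lemma le_of_monotone_of_step {φ : ℝ → ℝ} (hφ : Monotone φ) {a b : ℝ} (ha : 0 ≤ a)
    (h1 : ∀ t, φ (t + 1) ≤ φ t + 1) (hab : ∀ t, φ t + b ≤ φ (t + a)) : b ≤ a := by
  have hup : ∀ k : ℕ, φ k ≤ φ 0 + k := by
    intro k
    induction k with
    | zero => simp
    | succ k ih =>
      push_cast
      linarith [h1 k]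
  have hlow : ∀ n : ℕ, φ 0 + n * b ≤ φ (n * a) := by
    intro n
    induction n with
    | zero => simp
    | succ n ih =>
      have := hab (n * a)
      rw [show (n : ℝ) * a + a = ((n + 1 : ℕ) : ℝ) * a by push_cast; ring] at this
      push_cast at this ⊢
      linarith
  by_contra! hlt
  obtain ⟨n, hn⟩ := exists_nat_gt (1 / (b - a))
  rw [div_lt_iff₀ (by linarith)] at hn
  have h2 := hφ (Nat.le_ceil (n * a))
  have h3 := Nat.ceil_lt_add_one (a := (n : ℝ) * a) (by positivity)
  linarith [hup ⌈(n : ℝ) * a⌉₊, hlow n]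

lemma PreservesRight.le (hε₁ : 0 < ε₁) (hε₂ : 0 < ε₂)
    {f : unitDistGraph (strip ε₁) ≃g unitDistGraph (strip ε₂)} (hf : PreservesRight f) :
    ε₁ ≤ ε₂ := by
  obtain ⟨m, hm⟩ := exists_nat_ge (max ε₁ ε₂)
  have hm1 := (le_max_left _ _).trans hm
  have hm2 := (le_max_right _ _).trans hm
  have hm0 : (0 : ℝ) < m := by linarith
  let b : ℝ → strip ε₁ := fun t => mkPt t 0 (Set.left_mem_Icc.mpr hε₁.le)
  have hb0 : ∀ t, (b t).1 0 = t := fun t => mkPt_zero _ _ _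
  have hb1 : ∀ t, (b t).1 1 = 0 := fun t => mkPt_one _ _ _
  have hstep : ∀ t, (f (b (t + 1))).1 0 ≤ (f (b t)).1 0 + 1 := fun t => by
    have hadj : (unitDistGraph (strip ε₁)).Adj (b t) (b (t + 1)) := by
      rw [adj_iff, hb0, hb0, hb1, hb1]
      ring
    have h1 := adj_iff.mp (f.map_adj_iff.mpr hadj)
    nlinarith [sq_nonneg ((f (b t)).1 1 - (f (b (t + 1))).1 1)]
  have hmono : Monotone fun t => (f (b t)).1 0 := by
    refine StrictMono.monotone fun s t hst => hf.map_lt hε₁ hε₂ ?_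
    rwa [hb0, hb0]
  have hle : √(1 - (ε₂ / m) ^ 2) ≤ √(1 - (ε₁ / m) ^ 2) := by
    refine le_of_monotone_of_step hmono (Real.sqrt_nonneg _) hstep fun t => ?_
    have := hf.sqrt_le_sub hε₁ hε₂ hm1 (p := b t) (q := b (t + √(1 - (ε₁ / m) ^ 2)))
      (r := b (t + 1)) (by simp only [hb0]) (hstep t) (by simp only [hb0])
    dsimp only
    linarith
  have h1 : ε₁ / m ≤ 1 := (div_le_one hm0).mpr hm1
  have h0 : 0 ≤ ε₁ / m := by positivity
  rw [Real.sqrt_le_sqrt_iff (by nlinarith)] at hle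
  have h2 : ε₁ / m ≤ ε₂ / m := le_of_sq_le_sq (by linarith) (by positivity)
  exact (div_le_div_iff_of_pos_right hm0).mp h2

end StripGraph

open StripGraph in
theorem theorem1 (ε₁ ε₂ : ℝ) (hε₁ : 0 < ε₁) (hε₂ : 0 < ε₂) :
    Nonempty (unitDistGraph (strip ε₁) ≃g unitDistGraph (strip ε₂)) ↔ ε₁ = ε₂ := by
  constructor
  · rintro ⟨f⟩
    obtain ⟨g, hg⟩ := exists_preservesRight hε₁ hε₂ f
    exact le_antisymm (hg.le hε₁ hε₂) ((hg.symm hε₁ hε₂).le hε₂ hε₁)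
  · rintro rfl
    exact ⟨SimpleGraph.Iso.refl⟩
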